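/- For $n\ge 1$ let $[n]=\{1,\dots,n\}$, let $S_n$ be the set of permutations of $[n]$, and for a sequence of integers $a=a_1a_2\cdots a_n$ let $D(a)=\{i : 1\le i\le n-1,\ a_i>a_{i+1}\}$ be its descent set; for $\sigma\in S_n$ let $D(\sigma)$ be the descent set of its one-line notation $\sigma(1)\sigma(2)\cdots\sigma(n)$. Let $\mathcal T^0_n$ be the set of all sequences obtained from the one-line notation of an $n$-cycle in $S_n$ (a permutation consisting of one single cycle of length $n$; for $n=1$ this is the identity) by replacing one entry with $0$. Then for every $n\ge 1$ there is a bijection $\varphi:\mathcal T^0_n\to S_n$ such that, for every $\tau\in\mathcal T^0_n$ with image $\sigma=\varphi(\tau)$, we have $D(\tau)=D(\sigma)$ and, if $0$ is in position $k$ of $\tau$, then $\sigma(k)=1$. Consequently (Elizalde's conjecture), for every $I\subseteq[n-1]$, $$|\{\tau\in\mathcal T^0_n : D(\tau)=I\}|=|\{\sigma\in S_n : D(\sigma)=I\}|.$$ -/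

import Mathlib

namespace CyclicDescent

/-- The one-line notation `π(1) π(2) ⋯ π(n)` of a permutation `π ∈ S_n`, as a sequence of integers.
Positions and elements `0, …, n - 1` of `Fin n` stand for `1, …, n`, so position `j : Fin n` is the
`(j + 1)`-st position, and the entries are shifted by one so as to lie in `{1, …, n}`. -/
def oneLine {n : ℕ} (π : Equiv.Perm (Fin n)) : Fin n → ℤ :=
  fun j => ((π j : ℕ) : ℤ) + 1

/-- The descent set `{i : 1 ≤ i ≤ n - 1, a_i > a_{i+1}}` of a sequence of integers `a_1 ⋯ a_n`.
The entry `a_i` is `a ⟨i - 1, _⟩`, and `a_{i+1}` is `a ⟨i, _⟩`. -/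
def descentSet {n : ℕ} (a : Fin n → ℤ) : Set ℕ :=
  {i | ∃ (_ : 1 ≤ i) (h : i < n), a ⟨i - 1, lt_of_le_of_lt (Nat.sub_le i 1) h⟩ > a ⟨i, h⟩}

/-- `π ∈ S_n` is an `n`-cycle: it consists of a single cycle through all `n` elements. For `n = 1`
this includes the identity (a single cycle of length one). -/
def IsFullCycle {n : ℕ} (π : Equiv.Perm (Fin n)) : Prop :=
  π.IsCycleOn Set.univ

/-- The set `T⁰_n` of the sequences obtained from the one-line notation of an `n`-cycle by replacing
one entry with `0`. -/
def T0 (n : ℕ) : Set (Fin n → ℤ) :=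
  {τ | ∃ π : Equiv.Perm (Fin n), IsFullCycle π ∧ ∃ k : Fin n, τ = Function.update (oneLine π) k 0}

end CyclicDescent

namespace CyclicDescent

open Equiv

/-! Fix the position `k` of the zero. Summing over subsets reduces equality of the descent set to
containment in a set `J` (`card_fiber_eq_of_card_subset_eq`). Containment means increasing on the
blocks cut by `J`. As `k` carries the minimum, cutting on both sides of it changes nothing, so `k`
may be assumed alone in its block (`descentSet_subset_iff`); this frees the overwritten value `π k`.

With blocks as colours, both sides count rearrangements of the colour word that begin with the
colour of `k`. A permutation `σ` with `σ k = 0` gives the word `c ∘ σ⁻¹`, undone by stable sorting.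
An `n`-cycle gives the itinerary of `k`, undone by sorting the rotations of the word
lexicographically. -/

/-- `π` is increasing on every fibre of the colouring `c`. -/
def IncreasingOnFibers {n : ℕ} (c : Fin n → ℕ) (π : Perm (Fin n)) : Prop :=
  ∀ x y, x < y → c x = c y → π x < π y

/-- The rearrangements of the word `c` whose first letter is `c k`. -/
def rearrangements {n : ℕ} [NeZero n] (c : Fin n → ℕ) (k : Fin n) : Set (Fin n → ℕ) :=
  {w | w 0 = c k ∧ ∃ ρ : Perm (Fin n), w = c ∘ ρ}

/-- The itinerary of `k` under `π` with respect to the colouring `c`. -/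
def itinerary {n : ℕ} (c : Fin n → ℕ) (k : Fin n) (π : Perm (Fin n)) : Fin n → ℕ :=
  fun i => c ((π ^ (i : ℕ)) k)

/-- The infinite periodic word read off the cyclic word `w` from position `i` on. -/
def rotation {n : ℕ} [NeZero n] (w : Fin n → ℕ) (i : Fin n) : Lex (ℕ → ℕ) :=
  toLex fun m => w (i + Fin.ofNat n m)

/-! ### Permutations increasing on fibres, encoded as words -/

section Colouring

variable {n : ℕ} {c : Fin n → ℕ} {k : Fin n}

theorem eq_sort_of_increasingOnFibers (hc : Monotone c) {σ : Perm (Fin n)}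
    (h : IncreasingOnFibers c σ) : σ = Tuple.sort (c ∘ ⇑σ⁻¹) := by
  rw [Tuple.eq_sort_iff]
  have e : (c ∘ ⇑σ⁻¹) ∘ ⇑σ = c := by ext x; simp
  refine ⟨by rw [e]; exact hc, fun i j hij hw => h i j hij ?_⟩
  simpa using hw

theorem comp_sort_rearrangement (hc : Monotone c) (ρ : Perm (Fin n)) :
    (c ∘ ρ) ∘ Tuple.sort (c ∘ ρ) = c := by
  have h1 : Monotone (c ∘ ⇑(ρ * Tuple.sort (c ∘ ρ))) := Tuple.monotone_sort (c ∘ ρ)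
  have h2 : Monotone (c ∘ ⇑(1 : Perm (Fin n))) := hc
  exact Tuple.unique_monotone h1 h2

theorem IsFullCycle.exists_pow_eq {π : Perm (Fin n)} (hπ : IsFullCycle π) (x y : Fin n) :
    ∃ i < n, (π ^ i) x = y := by
  have h : π.IsCycleOn ((Finset.univ : Finset (Fin n)) : Set (Fin n)) := by
    simpa [IsFullCycle] using hπ
  simpa using h.exists_pow_eq (Finset.mem_univ x) (Finset.mem_univ y)

theorem IsFullCycle.pow_eq_pow {π : Perm (Fin n)} (hπ : IsFullCycle π) (x : Fin n) (i j : ℕ) :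
    (π ^ i) x = (π ^ j) x ↔ i ≡ j [MOD n] := by
  have h : π.IsCycleOn ((Finset.univ : Finset (Fin n)) : Set (Fin n)) := by
    simpa [IsFullCycle] using hπ
  simpa using h.pow_apply_eq_pow_apply (Finset.mem_univ x) (m := i) (n := j)

/-- Monotonicity on fibres carries the order of two orbit points forward as long as their colours
agree, and the first differing colour decides it. So the order depends only on the itinerary. -/
theorem itinerary_lt_of_lt (hc : Monotone c) {π π' : Perm (Fin n)}
    (h : IncreasingOnFibers c π) (h' : IncreasingOnFibers c π')
    (e : ∀ i, c ((π ^ i) k) = c ((π' ^ i) k)) (m : ℕ) :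
    ∀ i j, c ((π ^ (i + m)) k) ≠ c ((π ^ (j + m)) k) →
      (π ^ i) k < (π ^ j) k → (π' ^ i) k < (π' ^ j) k := by
  induction m with
  | zero =>
    intro i j hne hlt
    have := lt_of_le_of_ne (hc hlt.le) hne
    rw [e, e] at this
    exact hc.reflect_lt this
  | succ m ih =>
    intro i j hne hlt
    by_cases hij : c ((π ^ i) k) = c ((π ^ j) k)
    · have h1 : (π ^ (i + 1)) k < (π ^ (j + 1)) k := by
        simpa [pow_succ'] using h _ _ hlt hij
      have h2 := ih (i + 1) (j + 1) (by simpa [add_assoc, add_comm 1 m] using hne) h1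
      simp only [pow_succ', Perm.mul_apply] at h2
      rw [e, e] at hij
      rcases lt_trichotomy ((π' ^ i) k) ((π' ^ j) k) with h3 | h3 | h3
      · exact h3
      · rw [h3] at h2
        exact absurd h2 (lt_irrefl _)
      · exact absurd (h' _ _ h3 hij.symm) h2.asymm
    · have := lt_of_le_of_ne (hc hlt.le) hij
      rw [e, e] at this
      exact hc.reflect_lt this

theorem perm_eq_one_of_strictMono {u : Perm (Fin n)} (hu : StrictMono u) : u = 1 := by
  ext x
  have : (hu.orderIsoOfSurjective u u.surjective) = OrderIso.refl (Fin n) :=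
    Subsingleton.elim _ _
  have := congrArg (fun f => f x) this
  simpa using congrArg Fin.val this

variable [NeZero n]

theorem ncard_increasingOnFibers (hc : Monotone c) (hk : ∀ x, c x = c k → x = k) :
    {σ : Perm (Fin n) | σ k = 0 ∧ IncreasingOnFibers c σ}.ncard =
      (rearrangements c k).ncard := by
  have himage : (fun σ : Perm (Fin n) => c ∘ ⇑σ⁻¹) ''
      {σ | σ k = 0 ∧ IncreasingOnFibers c σ} = rearrangements c k := by
    ext w
    constructor
    · rintro ⟨σ, ⟨h0, -⟩, rfl⟩
      refine ⟨?_, σ⁻¹, rfl⟩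
      simp [← h0]
    · rintro ⟨h0, ρ, rfl⟩
      have hs := comp_sort_rearrangement hc ρ
      set s := Tuple.sort (c ∘ ρ) with hsdef
      have hs' : ∀ x, c (ρ (s x)) = c x := fun x => congrFun hs x
      refine ⟨s, ⟨?_, ?_⟩, ?_⟩
      · have : s⁻¹ 0 = k := by
          apply hk
          rw [← hs' (s⁻¹ 0)]
          simpa using h0
        rw [← this]
        simp
      · intro x y hxy hcxy
        exact ((Tuple.eq_sort_iff.1 hsdef).2 x y hxy (by simpa [hs'] using hcxy))
      · ext i
        simpa using (hs' (s⁻¹ i)).symm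
  rw [← himage, Set.InjOn.ncard_image]
  rintro σ ⟨-, h⟩ σ' ⟨-, h'⟩ e
  rw [eq_sort_of_increasingOnFibers hc h, eq_sort_of_increasingOnFibers hc h']
  exact congrArg Tuple.sort e

theorem itinerary_injOn (hc : Monotone c) (hk : ∀ x, c x = c k → x = k) :
    Set.InjOn (itinerary c k) {π | IsFullCycle π ∧ IncreasingOnFibers c π} := by
  rintro π ⟨hπ, h⟩ π' ⟨hπ', h'⟩ e
  have e' : ∀ i, c ((π ^ i) k) = c ((π' ^ i) k) := by
    intro i
    have hmod : i ≡ i % n [MOD n] := (Nat.mod_modEq i n).symm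
    rw [(hπ.pow_eq_pow k _ _).2 hmod, (hπ'.pow_eq_pow k _ _).2 hmod]
    exact congrFun e ⟨i % n, Nat.mod_lt _ (NeZero.pos n)⟩
  have hlt : ∀ i j, (π ^ i) k < (π ^ j) k → (π' ^ i) k < (π' ^ j) k := by
    intro i j hij
    -- When the first point reaches `k`, whose colour is unique, the colours must differ.
    obtain ⟨m, -, hm⟩ := hπ.exists_pow_eq ((π ^ i) k) k
    refine itinerary_lt_of_lt hc h h' e' m i j (fun hcc => hij.ne ?_) hij
    have him : (π ^ (i + m)) k = k := by rw [add_comm, pow_add]; exact hm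
    rw [him] at hcc
    have hjm := hk _ hcc.symm
    rw [add_comm, pow_add] at hjm
    rw [add_comm, pow_add] at him
    exact (π ^ m).injective (him.trans hjm.symm)
  choose t _ ht using hπ.exists_pow_eq k
  have hu : StrictMono fun x => (π' ^ t x) k := fun x y hxy =>
    hlt _ _ (by rwa [ht, ht])
  have hu1 := perm_eq_one_of_strictMono
    (u := Equiv.ofBijective _ (Finite.injective_iff_bijective.1 hu.injective)) hu
  have key : ∀ i, (π' ^ i) k = (π ^ i) k := by
    intro i
    have h1 : (π' ^ t ((π ^ i) k)) k = (π ^ i) k := congrArg (fun f : Perm _ => f ((π ^ i) k)) hu1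
    have h2 : t ((π ^ i) k) ≡ i [MOD n] := (hπ.pow_eq_pow k _ _).1 (ht _)
    rwa [(hπ'.pow_eq_pow k _ _).2 h2] at h1
  ext1 x
  obtain ⟨i, -, rfl⟩ := hπ.exists_pow_eq k x
  have h1 := key (i + 1)
  rw [pow_succ', pow_succ', Perm.mul_apply, Perm.mul_apply, key i] at h1
  exact h1.symm

theorem rotation_head_le {w : Fin n → ℕ} {i j : Fin n} (h : rotation w i < rotation w j) :
    w i ≤ w j := by
  obtain ⟨m, hm, hlt⟩ := h
  rcases Nat.eq_zero_or_pos m with rfl | hpos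
  · simpa [rotation] using hlt.le
  · simpa [rotation] using (hm 0 hpos).le

theorem ofNat_succ (m : ℕ) : Fin.ofNat n (m + 1) = Fin.ofNat n m + 1 :=
  Fin.ext (by simp [Fin.val_add, Nat.add_mod])

theorem rotation_succ_lt {w : Fin n → ℕ} {i j : Fin n} (h : rotation w i < rotation w j)
    (e : w i = w j) : rotation w (i + 1) < rotation w (j + 1) := by
  have shift : ∀ (a : Fin n) (m : ℕ), a + Fin.ofNat n (m + 1) = a + 1 + Fin.ofNat n m := by
    intro a m
    rw [ofNat_succ, add_assoc, add_comm 1]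
  obtain ⟨m, hm, hlt⟩ := h
  rcases m with _ | m
  · simp [rotation, e] at hlt
  · refine ⟨m, fun l hl => ?_, ?_⟩
    · have := hm (l + 1) (Nat.succ_lt_succ hl)
      change w _ = w _ at this
      rwa [shift, shift] at this
    · change w _ < w _ at hlt
      rwa [shift, shift] at hlt

theorem rotation_injective (hk : ∀ x, c x = c k → x = k) {w : Fin n → ℕ}
    (hw : w ∈ rearrangements c k) : Function.Injective (rotation w) := by
  obtain ⟨h0, ρ, rfl⟩ := hw
  intro i j hij
  -- Offset `-i` reads the initial letter of the word, which occurs only once and so locates the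
  -- start of the rotation.
  have hval : (c ∘ ρ) (i + Fin.ofNat n (-i : Fin n)) = (c ∘ ρ) (j + Fin.ofNat n (-i : Fin n)) :=
    congrFun (congrArg ofLex hij) ((-i : Fin n) : ℕ)
  have hcast : Fin.ofNat n ((-i : Fin n) : ℕ) = -i := by
    ext; simp
  rw [hcast, add_neg_cancel, h0] at hval
  have h1 := hk _ hval.symm
  have h2 := hk _ h0
  have h3 : j + -i = 0 := ρ.injective (h1.trans h2.symm)
  exact (eq_of_sub_eq_zero (by rwa [sub_eq_add_neg])).symm

theorem itinerary_surjOn (hc : Monotone c) (hk : ∀ x, c x = c k → x = k) :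
    Set.SurjOn (itinerary c k) {π | IsFullCycle π ∧ IncreasingOnFibers c π}
      (rearrangements c k) := by
  intro w hw
  have hinj := rotation_injective hk hw
  set s := Tuple.sort (rotation w)
  have hs : StrictMono (rotation w ∘ s) :=
    (Tuple.monotone_sort (rotation w)).strictMono_of_injective (hinj.comp s.injective)
  have hws : ∀ x, w (s x) = c x := by
    obtain ⟨-, ρ, rfl⟩ := hw
    -- Sorting rotations also sorts their first letters, and the only monotone rearrangement of `c`
    -- is `c`.
    have h1 : Monotone (c ∘ ⇑(ρ * s)) := by
      intro x y hxy
      rcases hxy.eq_or_lt with rfl | hlt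
      · exact le_rfl
      · exact rotation_head_le (w := c ∘ ρ) (hs hlt)
    have h2 : Monotone (c ∘ ⇑(1 : Perm (Fin n))) := hc
    exact fun x => congrFun (Tuple.unique_monotone h1 h2) x
  have hs0 : s⁻¹ 0 = k := by
    apply hk
    rw [← hws (s⁻¹ 0)]
    simpa using hw.1
  -- The cyclic shift of the word, with each rotation named by its rank.
  let π : Perm (Fin n) := s⁻¹ * Equiv.addRight 1 * s
  have hπ : ∀ x, s (π x) = s x + 1 := fun x => by simp [π]
  have hpow : ∀ (i : ℕ) (x : Fin n), s ((π ^ i) x) = s x + Fin.ofNat n i := by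
    intro i x
    induction i with
    | zero => simp
    | succ i ih =>
      rw [pow_succ', Perm.mul_apply, hπ, ih, add_assoc, ofNat_succ]
  refine ⟨π, ⟨⟨π.bijOn (by simp), fun x _ y _ => ?_⟩, fun x y hxy hcxy => ?_⟩, ?_⟩
  · refine ⟨((s y - s x : Fin n) : ℕ), s.injective ?_⟩
    rw [zpow_natCast, hpow]
    have hcast : Fin.ofNat n ((s y - s x : Fin n) : ℕ) = s y - s x := by ext; simp
    rw [hcast]
    abel
  · have h1 := rotation_succ_lt (hs hxy) (by rw [hws, hws, hcxy])
    rw [← hπ, ← hπ] at h1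
    exact hs.lt_iff_lt.1 h1
  · ext i
    rw [itinerary, ← hws, hpow, ← hs0]
    simp

theorem itinerary_mapsTo :
    Set.MapsTo (itinerary c k) {π | IsFullCycle π ∧ IncreasingOnFibers c π}
      (rearrangements c k) := by
  rintro π ⟨hπ, -⟩
  refine ⟨by simp [itinerary], ?_⟩
  have hinj : Function.Injective fun i : Fin n => (π ^ (i : ℕ)) k := by
    intro i j hij
    have := (hπ.pow_eq_pow k _ _).1 hij
    exact Fin.ext (Nat.ModEq.eq_of_lt_of_lt this i.2 j.2)
  exact ⟨Equiv.ofBijective _ (Finite.injective_iff_bijective.1 hinj), rfl⟩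

theorem ncard_fullCycle_increasingOnFibers (hc : Monotone c) (hk : ∀ x, c x = c k → x = k) :
    {π : Perm (Fin n) | IsFullCycle π ∧ IncreasingOnFibers c π}.ncard =
      {σ : Perm (Fin n) | σ k = 0 ∧ IncreasingOnFibers c σ}.ncard := by
  rw [ncard_increasingOnFibers hc hk,
    ← (itinerary_surjOn hc hk).image_eq_of_mapsTo itinerary_mapsTo,
    (itinerary_injOn hc hk).ncard_image]

end Colouring

/-! ### Descent sets and blocks -/

/-- The index of the block containing a position, when the positions are cut before each element
of `J`. -/
def blockIndex {n : ℕ} (J : Finset ℕ) (x : Fin n) : ℕ :=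
  (J.filter (· ≤ (x : ℕ))).card

theorem blockIndex_monotone {n : ℕ} (J : Finset ℕ) : Monotone (blockIndex (n := n) J) :=
  fun _ _ hxy => Finset.card_le_card fun i hi => by
    rw [Finset.mem_filter] at hi ⊢
    exact ⟨hi.1, hi.2.trans hxy⟩

theorem blockIndex_lt {n : ℕ} {J : Finset ℕ} {x y : Fin n} {i : ℕ} (hi : i ∈ J)
    (hx : (x : ℕ) < i) (hy : i ≤ y) : blockIndex J x < blockIndex J y := by
  apply Finset.card_lt_card
  refine ⟨fun l hl => ?_, fun h => ?_⟩
  · rw [Finset.mem_filter] at hl ⊢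
    exact ⟨hl.1, by omega⟩
  · have := h (Finset.mem_filter.2 ⟨hi, hy⟩)
    rw [Finset.mem_filter] at this
    omega

theorem blockIndex_eq {n : ℕ} {J : Finset ℕ} {x y : Fin n} (hxy : x ≤ y)
    (h : ∀ i ∈ J, ¬ ((x : ℕ) < i ∧ i ≤ y)) : blockIndex J x = blockIndex J y := by
  have hxy' : (x : ℕ) ≤ y := hxy
  unfold blockIndex
  congr 1
  apply Finset.filter_congr
  intro i hi
  have := h i hi
  omega

theorem eq_of_blockIndex_eq {n : ℕ} {J : Finset ℕ} {x k : Fin n}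
    (h : blockIndex (insert (k : ℕ) (insert ((k : ℕ) + 1) J)) x =
      blockIndex (insert (k : ℕ) (insert ((k : ℕ) + 1) J)) k) : x = k := by
  rcases lt_trichotomy x k with hx | hx | hx
  · exact absurd h (blockIndex_lt (i := k) (by simp) hx le_rfl).ne
  · exact hx
  · exact absurd h (blockIndex_lt (i := (k : ℕ) + 1) (by simp) (Nat.lt_succ_self _) hx).ne'

theorem descentSet_finite {n : ℕ} (a : Fin n → ℤ) : (descentSet a).Finite :=
  (Set.finite_Iio n).subset fun _ ⟨_, h, _⟩ => h

theorem descentSet_subset_iff {n : ℕ} {a : Fin n → ℤ} (ha : Function.Injective a) {k : Fin n}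
    (hmin : ∀ x, x ≠ k → a k < a x) {J : Finset ℕ} (hJ : (k : ℕ) = 0 ∨ (k : ℕ) ∈ J) :
    descentSet a ⊆ J ↔ ∀ x y : Fin n, x < y →
      blockIndex (insert (k : ℕ) (insert ((k : ℕ) + 1) J)) x =
        blockIndex (insert (k : ℕ) (insert ((k : ℕ) + 1) J)) y → a x < a y := by
  constructor
  · intro h x y hxy hb
    have step : ∀ d, ∀ hd : (x : ℕ) + d ≤ y, a x ≤ a ⟨x + d, hd.trans_lt y.2⟩ := by
      intro d
      induction d with
      | zero => intro _; exact le_rfl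
      | succ d ih =>
        intro hd
        refine (ih (by omega)).trans ?_
        by_contra hlt
        have hmem : (x : ℕ) + d + 1 ∈ descentSet a :=
          ⟨by omega, by omega, not_le.1 hlt⟩
        have hmemJ : (x : ℕ) + d + 1 ∈ J := h hmem
        exact (blockIndex_lt (x := x) (y := y)
          (Finset.mem_insert_of_mem (Finset.mem_insert_of_mem hmemJ))
          (by omega) (by omega)).ne hb
    have hxy' : (x : ℕ) < y := hxy
    have hle := step (y - x) (by omega)
    have hy : (⟨(x : ℕ) + (y - x), by omega⟩ : Fin n) = y := Fin.ext (by simp; omega)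
    rw [hy] at hle
    exact lt_of_le_of_ne hle fun e => hxy.ne (ha e)
  · rintro h i ⟨hi1, hin, hlt⟩
    by_contra hiJ
    have hiJ' : i ∉ J := hiJ
    by_cases hik : i = k + 1
    · subst hik
      have h1 := hmin ⟨(k : ℕ) + 1, hin⟩ (fun e => by simpa using congrArg Fin.val e)
      exact lt_asymm h1 hlt
    · have hik' : i ≠ k := by
        rintro rfl
        rcases hJ with hJ | hJ
        · omega
        · exact hiJ hJ
      refine lt_asymm hlt (h _ _ (Fin.mk_lt_mk.2 (by omega)) (blockIndex_eq ?_ ?_))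
      · exact Fin.mk_le_mk.2 (by omega)
      · rintro l hl ⟨h1, h2⟩
        have hli : l = i := by simp only at h1 h2; omega
        subst hli
        simp [hiJ', hik, hik'] at hl

theorem mem_descentSet_of_min {n : ℕ} {a : Fin n → ℤ} {k : Fin n}
    (hmin : ∀ x, x ≠ k → a k < a x) (hk : (k : ℕ) ≠ 0) : (k : ℕ) ∈ descentSet a :=
  ⟨by omega, k.2, hmin _ fun e => by
    have := congrArg Fin.val e
    simp only at this
    omega⟩

theorem oneLine_injective {n : ℕ} (π : Perm (Fin n)) : Function.Injective (oneLine π) := by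
  intro x y h
  simp only [oneLine, add_left_inj, Nat.cast_inj] at h
  exact π.injective (Fin.ext h)

theorem oneLine_pos {n : ℕ} (π : Perm (Fin n)) (x : Fin n) : 0 < oneLine π x := by
  simp only [oneLine]
  omega

theorem oneLine_lt_iff {n : ℕ} {π : Perm (Fin n)} {x y : Fin n} :
    oneLine π x < oneLine π y ↔ π x < π y := by
  simp [oneLine]

theorem update_oneLine_lt {n : ℕ} (π : Perm (Fin n)) {k x : Fin n} (hx : x ≠ k) :
    Function.update (oneLine π) k 0 k < Function.update (oneLine π) k 0 x := by
  simp [hx, oneLine_pos]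

theorem update_oneLine_injective {n : ℕ} (π : Perm (Fin n)) (k : Fin n) :
    Function.Injective (Function.update (oneLine π) k 0) := by
  intro x y h
  by_cases hx : x = k <;> by_cases hy : y = k
  · rw [hx, hy]
  · subst hx; exact absurd h (update_oneLine_lt π hy).ne
  · subst hy; exact absurd h (update_oneLine_lt π hx).ne'
  · simp only [Function.update_of_ne hx, Function.update_of_ne hy] at h
    exact oneLine_injective π h

theorem oneLine_lt_of_apply_eq_zero {n : ℕ} [NeZero n] {σ : Perm (Fin n)} {k x : Fin n}
    (h : σ k = 0) (hx : x ≠ k) : oneLine σ k < oneLine σ x := by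
  rw [oneLine_lt_iff, h, Fin.pos_iff_ne_zero, ← h]
  exact fun e => hx (σ.injective e)

theorem ncard_descentSet_subset {n : ℕ} [NeZero n] (k : Fin n) (J : Finset ℕ) :
    {π : Perm (Fin n) | IsFullCycle π ∧
      descentSet (Function.update (oneLine π) k 0) ⊆ J}.ncard =
    {σ : Perm (Fin n) | σ k = 0 ∧ descentSet (oneLine σ) ⊆ J}.ncard := by
  by_cases hJ : (k : ℕ) = 0 ∨ (k : ℕ) ∈ J
  · have hfib := fun x (h : blockIndex (insert (k : ℕ) (insert ((k : ℕ) + 1) J)) x =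
        blockIndex (insert (k : ℕ) (insert ((k : ℕ) + 1) J)) k) => eq_of_blockIndex_eq h
    convert ncard_fullCycle_increasingOnFibers
      (blockIndex_monotone (insert (k : ℕ) (insert ((k : ℕ) + 1) J))) hfib using 4 with π σ
    · rw [descentSet_subset_iff (update_oneLine_injective π k)
        (fun x hx => update_oneLine_lt π hx) hJ]
      -- Pairs within one block never involve `k`, so the zero is invisible here.
      refine and_congr_right fun _ => forall₄_congr fun x y hxy hb => ?_
      have hx : x ≠ k := by
        rintro rfl
        exact hxy.ne' (hfib y hb.symm)
      have hy : y ≠ k := by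
        rintro rfl
        exact hxy.ne (hfib x hb)
      rw [Function.update_of_ne hx, Function.update_of_ne hy, oneLine_lt_iff]
    · refine and_congr_right fun h0 => ?_
      rw [descentSet_subset_iff (oneLine_injective σ)
        (fun x hx => oneLine_lt_of_apply_eq_zero h0 hx) hJ]
      simp only [oneLine_lt_iff, IncreasingOnFibers]
  -- The minimum at `k` forces a descent outside `J`, so both sets are empty.
  · rw [not_or] at hJ
    have h1 : {π : Perm (Fin n) | IsFullCycle π ∧
        descentSet (Function.update (oneLine π) k 0) ⊆ J} = ∅ :=
      Set.eq_empty_of_forall_notMem fun π hπ => hJ.2 <|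
        hπ.2 (mem_descentSet_of_min (fun x hx => update_oneLine_lt π hx) hJ.1)
    have h2 : {σ : Perm (Fin n) | σ k = 0 ∧ descentSet (oneLine σ) ⊆ J} = ∅ :=
      Set.eq_empty_of_forall_notMem fun σ hσ => hJ.2 <|
        hσ.2 (mem_descentSet_of_min (fun x hx => oneLine_lt_of_apply_eq_zero hσ.1 hx) hJ.1)
    rw [h1, h2]

/-! ### From counts to the bijection -/

theorem card_fiber_subset {γ ι : Type*} [Fintype γ] [DecidableEq ι] (f : γ → Finset ι)
    (J : Finset ι) :
    (Finset.univ.filter fun a => f a ⊆ J).card =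
      ∑ K ∈ J.ssubsets, (Finset.univ.filter fun a => f a = K).card +
        (Finset.univ.filter fun a => f a = J).card := by
  rw [Finset.ssubsets, Finset.sum_erase_add _ _ (Finset.mem_powerset_self J),
    Finset.card_eq_sum_card_fiberwise (f := f) (t := J.powerset)
      (fun a ha => by simpa using ha)]
  refine Finset.sum_congr rfl fun K hK => ?_
  rw [Finset.filter_filter]
  congr 1
  apply Finset.filter_congr
  intro a _
  constructor
  · exact fun h => h.2
  · rintro rfl
    exact ⟨Finset.mem_powerset.1 hK, rfl⟩

theorem card_fiber_eq_of_card_subset_eq {α β ι : Type*} [Fintype α] [Fintype β] [DecidableEq ι]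
    (f : α → Finset ι) (g : β → Finset ι)
    (h : ∀ J, (Finset.univ.filter fun a => f a ⊆ J).card =
      (Finset.univ.filter fun b => g b ⊆ J).card) (J : Finset ι) :
    (Finset.univ.filter fun a => f a = J).card = (Finset.univ.filter fun b => g b = J).card := by
  induction J using Finset.strongInduction with
  | H J ih =>
    have h1 := card_fiber_subset f J
    have h2 := card_fiber_subset g J
    have h3 := Finset.sum_congr rfl fun K hK => ih K (Finset.mem_ssubsets.1 hK)
    have h4 := h J
    omega

theorem exists_equiv_of_card_fiber_eq {α β κ : Type*} [Fintype α] [Fintype β] [DecidableEq κ]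
    (f : α → κ) (g : β → κ)
    (h : ∀ c, (Finset.univ.filter fun a => f a = c).card =
      (Finset.univ.filter fun b => g b = c).card) :
    ∃ e : α ≃ β, ∀ a, g (e a) = f a := by
  have e : ∀ c, Nonempty ({a // f a = c} ≃ {b // g b = c}) := fun c =>
    ⟨Fintype.equivOfCardEq (by rw [Fintype.card_subtype, Fintype.card_subtype, h])⟩
  refine ⟨(Equiv.sigmaFiberEquiv f).symm.trans
    ((Equiv.sigmaCongrRight fun c => (e c).some).trans (Equiv.sigmaFiberEquiv g)), fun a => ?_⟩
  exact ((e (f a)).some ⟨a, rfl⟩).2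

theorem exists_equiv_fullCycle {n : ℕ} [NeZero n] (k : Fin n) :
    ∃ e : {π : Perm (Fin n) // IsFullCycle π} ≃ {σ : Perm (Fin n) // σ⁻¹ 0 = k}, ∀ π,
      descentSet (oneLine (e π : Perm (Fin n))) =
        descentSet (Function.update (oneLine (π : Perm (Fin n))) k 0) := by
  classical
  let f : {π : Perm (Fin n) // IsFullCycle π} → Finset ℕ := fun π =>
    (descentSet_finite (Function.update (oneLine (π : Perm (Fin n))) k 0)).toFinset
  let g : {σ : Perm (Fin n) // σ⁻¹ 0 = k} → Finset ℕ := fun σ =>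
    (descentSet_finite (oneLine (σ : Perm (Fin n)))).toFinset
  have hcard : ∀ (p q : Perm (Fin n) → Prop)
      [Fintype (Subtype p)], (Finset.univ.filter fun a : Subtype p => q a).card = {x | p x ∧ q x}.ncard := by
    intro p q _
    rw [← Set.ncard_coe_finset, ← Set.ncard_image_of_injective _ Subtype.val_injective]
    congr 1
    ext x
    simp [and_comm]
  obtain ⟨e, he⟩ := exists_equiv_of_card_fiber_eq f g
    (card_fiber_eq_of_card_subset_eq f g fun J => by
      simp only [f, g, Set.Finite.toFinset_subset]
      refine (hcard IsFullCycle
        fun π => descentSet (Function.update (oneLine π) k 0) ⊆ ↑J).trans ?_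
      refine Eq.trans ?_
        (hcard (fun σ => σ⁻¹ 0 = k) fun σ => descentSet (oneLine σ) ⊆ ↑J).symm
      rw [ncard_descentSet_subset]
      simp only [Perm.inv_eq_iff_eq, eq_comm (a := (0 : Fin n))])
  exact ⟨e, fun π => by simpa [f, g] using he π⟩

/-- The other entries are positive, so the zero reveals `k`; the lost entry is the one value not
taken elsewhere. -/
theorem update_oneLine_eq_iff {n : ℕ} {π π' : Perm (Fin n)} {k k' : Fin n}
    (h : Function.update (oneLine π) k 0 = Function.update (oneLine π') k' 0) :
    k = k' ∧ π = π' := by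
  have hk : k = k' := by
    by_contra hne
    have := congrFun h k
    rw [Function.update_self, Function.update_of_ne hne] at this
    exact (oneLine_pos π' k).ne this
  subst hk
  refine ⟨rfl, ?_⟩
  have hoff : ∀ x, x ≠ k → π x = π' x := by
    intro x hx
    have := congrFun h x
    rw [Function.update_of_ne hx, Function.update_of_ne hx] at this
    simpa [oneLine, Fin.ext_iff] using this
  ext1 x
  by_cases hx : x = k
  · subst hx
    by_contra hne
    obtain ⟨y, hy⟩ := π'.surjective (π x)
    have hyx : y ≠ x := by
      rintro rfl
      exact hne hy.symm
    exact hyx (π.injective ((hoff y hyx).trans hy))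
  · exact hoff x hx

theorem exists_equiv_T0 (n : ℕ) [NeZero n] :
    ∃ β : T0 n ≃ Perm (Fin n), ∀ τ : T0 n,
      descentSet (τ : Fin n → ℤ) = descentSet (oneLine (β τ)) ∧
        ∀ k : Fin n, (τ : Fin n → ℤ) k = 0 → oneLine (β τ) k = 1 := by
  choose e he using exists_equiv_fullCycle (n := n)
  let ψ : (Σ _ : Fin n, {π : Perm (Fin n) // IsFullCycle π}) → T0 n := fun p =>
    ⟨Function.update (oneLine (p.2 : Perm (Fin n))) p.1 0, p.2, p.2.2, p.1, rfl⟩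
  have hψ : Function.Bijective ψ := by
    constructor
    · rintro ⟨k, π⟩ ⟨k', π'⟩ h
      obtain ⟨rfl, h2⟩ := update_oneLine_eq_iff (congrArg Subtype.val h)
      obtain rfl : π = π' := Subtype.ext h2
      rfl
    · rintro ⟨_, π, hπ, k, rfl⟩
      exact ⟨⟨k, π, hπ⟩, rfl⟩
  let Ψ := Equiv.ofBijective ψ hψ
  let E := (Equiv.sigmaCongrRight e).trans (Equiv.sigmaFiberEquiv fun σ : Perm (Fin n) => σ⁻¹ 0)
  refine ⟨Ψ.symm.trans E, fun τ => ?_⟩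
  obtain ⟨⟨k, π⟩, rfl⟩ := Ψ.surjective τ
  have hE : (Ψ.symm.trans E) (Ψ ⟨k, π⟩) = (e k π : Perm (Fin n)) := by
    rw [Equiv.trans_apply, Equiv.symm_apply_apply]
    rfl
  rw [hE]
  refine ⟨(he k π).symm, fun j hj => ?_⟩
  have hjk : j = k := by
    by_contra hne
    have hj' : Function.update (oneLine (π : Perm (Fin n))) k 0 j = 0 := hj
    rw [Function.update_of_ne hne] at hj'
    exact (oneLine_pos _ j).ne' hj'
  subst hjk
  have h0 : (e j π : Perm (Fin n)) j = 0 := (Perm.inv_eq_iff_eq.1 (e j π).2).symm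
  simp [oneLine, h0]

end CyclicDescent

theorem corollary3 (n : ℕ) (hn : 1 ≤ n) :
    (∃ β : CyclicDescent.T0 n ≃ Equiv.Perm (Fin n), ∀ τ : CyclicDescent.T0 n,
      CyclicDescent.descentSet (τ : Fin n → ℤ) =
          CyclicDescent.descentSet (CyclicDescent.oneLine (β τ)) ∧
        ∀ k : Fin n, (τ : Fin n → ℤ) k = 0 → CyclicDescent.oneLine (β τ) k = 1) ∧
    (∀ I : Set ℕ, I ⊆ Set.Icc 1 (n - 1) →
      Set.ncard {τ : Fin n → ℤ | τ ∈ CyclicDescent.T0 n ∧ CyclicDescent.descentSet τ = I} =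
        Set.ncard {σ : Equiv.Perm (Fin n) |
          CyclicDescent.descentSet (CyclicDescent.oneLine σ) = I}) := by
  have : NeZero n := ⟨by omega⟩
  obtain ⟨β, hβ⟩ := CyclicDescent.exists_equiv_T0 n
  refine ⟨⟨β, hβ⟩, fun I _ => ?_⟩
  refine Set.ncard_congr (fun τ hτ => β ⟨τ, hτ.1⟩) ?_ ?_ ?_
  · rintro τ ⟨hτ, hI⟩
    exact ((hβ ⟨τ, hτ⟩).1.symm.trans hI :)
  · intro τ τ' hτ hτ' h
    exact congrArg Subtype.val (β.injective h)
  · intro σ hσ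
    refine ⟨β.symm σ, ⟨(β.symm σ).2, ?_⟩, by simp⟩
    rw [(hβ _).1, β.apply_symm_apply]
    exact hσ
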